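/- Throughout, a monoid is a commutative cancellative semigroup with unit element (except that in the definition of weak transfer homomorphisms commutativity is not needed), $\mathbb N$ is the set of positive integers and $\mathbb N_0=\mathbb N\cup\{0\}$. Let $H$ be a monoid with group of units $H^\times$, and let $\mathfrak m=H\setminus H^\times$. An atom is a non-unit that is not a product of two non-units; $H$ is atomic if every non-unit is a finite product of atoms. For $a\in\mathfrak m$ let $\mathsf L(a)\subset\mathbb N$ be the set of all $k\in\mathbb N$ such that $a$ is a product of $k$ atoms; for $a\in H^\times$ put $\mathsf L(a)=\{0\}$. Let $\mathcal L(H)=\{\mathsf L(a)\mid a\in H\}$, and call $H$ half-factorial if $|L|=1$ for all $L\in\mathcal L(H)$. For $L\subset\mathbb N$ let $\rho(L)=\sup L/\min L$, and let $\rho(\{0\})=1$. A distance of $L$ is a $d\in\mathbb N$ such that there is an $a\in L$ with $a+d\in L$ and with no element of $L$ strictly between $a$ and $a+d$; $\Delta(H)$ is the set of all distances of all $L\in\mathcal L(H)$. If $H\neq H^\times$, then $\rho_k(H)=\sup\{\sup L\mid k\in L\in\mathcal L(H)\}$ for $k\in\mathbb N$. $H$ is strongly primary if $\mathfrak m\ne\emptyset$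 and for every $a\in\mathfrak m$ there is an $n\in\mathbb N$ with $\mathfrak m^n\subset aH$; the smallest such $n$ is denoted by $\mathcal M(a)$. For a subset $G_0$ of an abelian group, $\mathcal B(G_0)$ is the monoid of finite unordered sequences over $G_0$ (repetition allowed) with sum $0$, under concatenation, and $\mathcal L(G_0)=\mathcal L(\mathcal B(G_0))$. A homomorphism $\theta\colon H\to B$ to an atomic monoid $B$ is a weak transfer homomorphism if $B=B^\times\theta(H)B^\times$, $\theta^{-1}(B^\times)=H^\times$, and whenever $\theta(a)=v_1\cdots v_n$ with $a \in H$, $n\in\mathbb N$ and atoms $v_i$ of $B$, there are atoms $u_i$ of $H$ and a permutation $\tau$ of $\{1,\dots,n\}$ with $a=u_1\cdots u_n$ and $\theta(u_i)\in B^\times v_{\tau(i)}B^\times$ for all $i$. $H$ is transfer Krull if it has a weak transfer homomorphism to $\mathcal B(G_0)$ for some subset $G_0$ of some abelian group. Let $\mathsf Z(H)$ be the free abelian monoid on the set of atoms of $H_{\rm red}=H/H^\times$, and let $\mathsf Z(a)\subset\mathsf Z(H)$ be the set of formal products of atoms whose product in $H_{\rm red}$ is $aH^\times$. For $z,z'\in\mathsf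 Z(H)$ with greatest common divisor $g$ let $\mathsf d(z,z')=\max\{|g^{-1}z|,|g^{-1}z'|\}$, where $|\cdot|$ is the number of factors. An atomic monoid $H$ is locally tame if for every atom $u$ of $H_{\rm red}$ there is an $N\in\mathbb N_0$ such that for all $a\in H$ with $\mathsf Z(a)\cap u\mathsf Z(H)\neq\emptyset$ and all $z\in\mathsf Z(a)$ there is a $z'\in\mathsf Z(a)\cap u\mathsf Z(H)$ with $\mathsf d(z,z')\le N$. For $d\in\mathbb N$, $M\in\mathbb N_0$ and $\{0,d\}\subset\mathcal D\subset[0,d]$, a set $L\subset\mathbb Z$ is an AAMP (almost arithmetical multiprogression) with difference $d$, period $\mathcal D$ and bound $M$ if $L=y+(L'\cup L^*\cup L'')\subset y+\mathcal D+d\mathbb Z$ with $y\in\mathbb Z$, where $L^*$ is finite and nonempty, $\min L^*=0$, $L^*=(\mathcal D+d\mathbb Z)\cap[0,\max L^*]$, $L'\subset[-M,-1]$ and $L''\subset\max L^*+[1,M]$. **Theorem.** Let $H$ be a strongly primary monoid that is not half-factorial. 1. There is a $\beta\in\mathbb Q$ with $\beta>1$ such that $\rho(L)\ge\beta$ for all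 $L\in\mathcal L(H)$ with $\rho(L)\neq1$. 2. $\mathcal L(H)\neq\mathcal L(G_0)$ for every subset $G_0$ of every abelian group. In particular, $H$ is not transfer Krull. 3. If $\sup\{\min\mathsf L(c)\mid c\in H\}<\infty$, or if there is a $u\in H\setminus H^\times$ with $\rho_{\mathcal M(u)}(H)<\infty$, then $H$ is locally tame. If $H$ is locally tame, then $\Delta(H)$ is finite, and there is an $M\in\mathbb N_0$ such that every $L\in\mathcal L(H)$ is an AAMP with difference $\min\Delta(H)$, period $\{0,\min\Delta(H)\}$ and bound $M$. -/

import Mathlib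

open scoped Pointwise ENNReal

universe u v

namespace FactorizationTheory

section Monoids

variable {H : Type u} [Monoid H]

/-- The set of lengths of `a`: it is `{0}` if `a` is invertible, and otherwise the set of all
`k ≥ 1` such that `a` is a product of `k` atoms. -/
def setOfLengths (a : H) : Set ℕ :=
  {k | (IsUnit a ∧ k = 0) ∨
    (¬ IsUnit a ∧ 0 < k ∧
      ∃ l : List H, l.length = k ∧ (∀ x ∈ l, Irreducible x) ∧ l.prod = a)}

variable (H) in
/-- The system of sets of lengths `{L(a) | a ∈ H}`. -/
def lengthSystem : Set (Set ℕ) := Set.range (setOfLengths : H → Set ℕ)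

variable (H) in
/-- Every non-invertible element is a product of finitely many atoms. -/
def IsAtomicMonoid : Prop :=
  ∀ a : H, ¬ IsUnit a → ∃ l : List H, (∀ x ∈ l, Irreducible x) ∧ l.prod = a

variable (H) in
/-- Every set of lengths has exactly one element. -/
def IsHalfFactorial : Prop := ∀ L ∈ lengthSystem H, L.encard = 1

open Classical in
/-- The elasticity `sup A / min A` of a set of nonnegative integers, with value `1` at `{0}`. -/
noncomputable def elasticity (A : Set ℕ) : ℝ≥0∞ :=
  if A = {0} then 1 else (⨆ n ∈ A, (n : ℝ≥0∞)) / ((sInf A : ℕ) : ℝ≥0∞)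

/-- The set of distances of a set of nonnegative integers. -/
def distances (A : Set ℕ) : Set ℕ :=
  {d | 0 < d ∧ ∃ a ∈ A, a + d ∈ A ∧ ∀ c ∈ A, ¬ (a < c ∧ c < a + d)}

variable (H) in
/-- The set of distances of a monoid. -/
def distanceSet : Set ℕ := ⋃ L ∈ lengthSystem H, distances L

open Classical in
variable (H) in
/-- The `k`-th elasticity of a monoid. -/
noncomputable def kthElasticity (k : ℕ) : ℕ∞ :=
  if ∀ a : H, IsUnit a then (k : ℕ∞)
  else ⨆ L ∈ {L | L ∈ lengthSystem H ∧ k ∈ L}, ⨆ n ∈ L, (n : ℕ∞)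

/-- Weak transfer homomorphisms of (not necessarily commutative) monoids. -/
structure IsWeakTransferHom {B : Type v} [Monoid B] (θ : H →* B) : Prop where
  atomic : IsAtomicMonoid B
  surj : ∀ b : B, ∃ (ε η : Bˣ) (a : H), b = ε * θ a * η
  isUnit_iff : ∀ a : H, IsUnit (θ a) ↔ IsUnit a
  lift : ∀ (a : H) (n : ℕ), 0 < n → ∀ w : Fin n → B, (∀ i, Irreducible (w i)) →
    θ a = (List.ofFn w).prod →
    ∃ (x : Fin n → H) (τ : Equiv.Perm (Fin n)),
      (∀ i, Irreducible (x i)) ∧ a = (List.ofFn x).prod ∧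
      ∀ i, ∃ ε η : Bˣ, θ (x i) = ε * w (τ i) * η

end Monoids

/-- The zero-sum sequences over `G₀`, inside the free abelian monoid with basis `G₀`
(written additively, as multisets of elements of `G₀`). -/
def zeroSumSequences {G : Type v} [AddCommGroup G] (G₀ : Set G) : AddSubmonoid (Multiset G₀) where
  carrier := {S | (S.map (fun g : G₀ => (g : G))).sum = 0}
  zero_mem' := by simp
  add_mem' := by
    intro a b ha hb
    simp only [Set.mem_ofPred_eq] at ha hb ⊢
    rw [Multiset.map_add, Multiset.sum_add, ha, hb, add_zero]

/-- The monoid `B(G₀)` of zero-sum sequences over `G₀`, written multiplicatively. -/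
abbrev ZeroSumMonoid {G : Type v} [AddCommGroup G] (G₀ : Set G) : Type v :=
  Multiplicative (zeroSumSequences G₀)

/-- `H` has a weak transfer homomorphism to `B(G₀)` for a subset `G₀` of an abelian group. -/
def IsTransferKrull (H : Type u) [Monoid H] : Prop :=
  ∃ (G : Type v) (_ : AddCommGroup G) (G₀ : Set G) (θ : H →* ZeroSumMonoid G₀),
    IsWeakTransferHom θ

section Commutative

variable (H : Type u) [CancelCommMonoid H]

/-- Strongly primary monoids; `nonunits H` is the set of non-invertible elements, and its
`n`-th power is the set of all products of `n` non-invertible elements. -/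
def IsStronglyPrimary : Prop :=
  (nonunits H).Nonempty ∧
    ∀ a ∈ nonunits H, ∃ n : ℕ, 0 < n ∧ nonunits H ^ n ⊆ {x | a ∣ x}

variable {H}

/-- The smallest `n ≥ 1` such that every product of `n` non-invertible elements is divisible
by `a` (used for non-invertible `a` in strongly primary monoids). -/
noncomputable def primaryExponent (a : H) : ℕ :=
  sInf {n : ℕ | 0 < n ∧ nonunits H ^ n ⊆ {x | a ∣ x}}

variable (H) in
/-- The factorization monoid: the free abelian monoid (written additively, as multisets) on the
atoms of the reduced monoid `Associates H` associated with `H`. -/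
abbrev Factorization : Type u := Multiset {p : Associates H // Irreducible p}

/-- The factorizations of `a`. -/
def factorizations (a : H) : Set (Factorization H) :=
  {z | (z.map (fun p : {p : Associates H // Irreducible p} => (p : Associates H))).prod
    = Associates.mk a}

open Classical in
/-- The distance of two factorizations: cancel the greatest common divisor of `z` and `z'`, and
take the maximum of the two remaining lengths. -/
noncomputable def factorizationDist (z z' : Factorization H) : ℕ :=
  max (Multiset.card (z - z ∩ z')) (Multiset.card (z' - z ∩ z'))

/-- The tame degree `t(a, x)`: the smallest `N` such that, if some factorization of `a` is
divisible by `x`, then for every factorization `z` of `a` there is a factorization of `a` that is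
divisible by `x` and has distance at most `N` from `z`. -/
noncomputable def tameDegree (a : H) (x : Factorization H) : ℕ∞ :=
  sInf {N : ℕ∞ | (∃ z' ∈ factorizations a, x ≤ z') →
    ∀ z ∈ factorizations a, ∃ z' ∈ factorizations a,
      x ≤ z' ∧ (factorizationDist z z' : ℕ∞) ≤ N}

variable (H) in
/-- An atomic monoid is locally tame if, for every atom `p` of the reduced monoid, the tame degrees
`t(a, p)`, `a ∈ H`, are bounded. -/
def IsLocallyTame : Prop :=
  IsAtomicMonoid H ∧
    ∀ p : {p : Associates H // Irreducible p}, (⨆ a : H, tameDegree a {p}) < ⊤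

end Commutative

/-- Almost arithmetical multiprogressions with difference `d`, period `D` and bound `M`. Here
`Lc` is the central part, `L₁` the initial part and `L₂` the end part. -/
def IsAAMP (d : ℕ) (D : Set ℤ) (M : ℕ) (L : Set ℤ) : Prop :=
  0 < d ∧ {0, (d : ℤ)} ⊆ D ∧ D ⊆ Set.Icc 0 (d : ℤ) ∧
  ∃ (y m : ℤ) (L₁ Lc L₂ : Set ℤ),
    L = {y} + (L₁ ∪ Lc ∪ L₂) ∧
    L ⊆ {y} + D + Set.range (fun k : ℤ => (d : ℤ) * k) ∧
    Lc.Finite ∧ IsLeast Lc 0 ∧ IsGreatest Lc m ∧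
    Lc = (D + Set.range (fun k : ℤ => (d : ℤ) * k)) ∩ Set.Icc 0 m ∧
    L₁ ⊆ Set.Icc (-(M : ℤ)) (-1) ∧
    L₂ ⊆ Set.Icc (m + 1) (m + M)

end FactorizationTheory

open FactorizationTheory

/-!
Let `n = M(a)`. In a strongly primary monoid an element `b` with a length at least `q * n` is
divisible by `a ^ q`, and all lengths of `a` are at most `n`. Choose `a` with two lengths `k` and
`k + d`.

* If `N = max L(b)`, then `a ^ (N / n)` divides `b`, so `L(b)` has two elements whose difference is
  at least `N / n`. Hence `max L(b) - min L(b)` is at least a fixed proportion of `min L(b)` unless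
  `b` has only one length, which gives the gap above `1` for the elasticities.
* For the same reason `{n}` is not a set of lengths of `H`. In a monoid of zero-sum sequences a
  nonzero element of minimal support and, among these, of minimal size is absolutely irreducible, so
  its powers realize all `{k}`. Weak transfer homomorphisms preserve sets of lengths.
* To force an atom `u` into a factorization of `b`, it suffices to exchange `M(u)` of its atoms, and
  the cost is the length of a factorization of the cofactor of `u` in their product. This is bounded
  if minimal lengths are, and also if `ρ_{M(a)}` is finite for some non-unit `a`: then the exponent
  of `a` in a product of few atoms is bounded, hence so are all its lengths.
* If `H` is locally tame, passing from `L(a * b)` to `L(b)` moves lengths by `k` up to a bounded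
  error. This bounds the distances, say by `D`. The set `L(a ^ D)` contains the progression
  `D * k, D * k + d, …, D * k + D * d` with `d = min Δ(H)`, which fills all gaps of `L(r)`, so
  `L(a ^ D * r)` is a full progression up to bounded initial and end parts; elements that are not
  divisible by `a ^ D` have bounded lengths.
-/

namespace FactorizationTheory

section Lengths

theorem exists_le_card_eq {α : Type*} {n : ℕ} {s : Multiset α} (h : n ≤ s.card) :
    ∃ t ≤ s, t.card = n := by
  induction s using Quotient.inductionOn with
  | h l => exact ⟨l.take n, (l.take_sublist n).subperm, by simpa using h⟩

variable {H : Type u} [CommMonoid H]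

theorem eq_zero_of_isUnit_prod {s : Multiset H} (hs : ∀ x ∈ s, ¬ IsUnit x)
    (h : IsUnit s.prod) : s = 0 :=
  Multiset.eq_zero_of_forall_notMem fun x hx =>
    hs x hx (isUnit_of_dvd_unit (Multiset.dvd_prod hx) h)

theorem exists_irreducible_prod_eq_of_associated {s : Multiset H}
    (hs : ∀ x ∈ s, Irreducible x) {a : H} (ha : ¬ IsUnit a) (h : Associated s.prod a) :
    ∃ t : Multiset H, t.card = s.card ∧ (∀ x ∈ t, Irreducible x) ∧ t.prod = a := by
  obtain ⟨w, hw⟩ := h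
  rcases s.empty_or_exists_mem with rfl | ⟨x, hx⟩
  · exact absurd ⟨w, by simpa using hw⟩ ha
  · obtain ⟨t, rfl⟩ := Multiset.exists_cons_of_mem hx
    rw [Multiset.forall_mem_cons] at hs
    refine ⟨(x * w) ::ₘ t, by simp, ?_, ?_⟩
    · rw [Multiset.forall_mem_cons]
      exact ⟨(irreducible_mul_units w).2 hs.1, hs.2⟩
    · rw [← hw, Multiset.prod_cons, Multiset.prod_cons, mul_right_comm]

theorem mem_setOfLengths_iff {a : H} {k : ℕ} :
    k ∈ setOfLengths a ↔ ∃ s : Multiset H, s.card = k ∧ (∀ x ∈ s, Irreducible x) ∧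
      Associated s.prod a := by
  constructor
  · rintro (⟨ha, rfl⟩ | ⟨-, -, l, rfl, hl, rfl⟩)
    · exact ⟨0, rfl, by simp, by simpa using (associated_one_iff_isUnit.2 ha).symm⟩
    · exact ⟨l, by simp, by simpa using hl, by simp⟩
  · rintro ⟨s, rfl, hs, hsa⟩
    by_cases ha : IsUnit a
    · left
      exact ⟨ha, Multiset.card_eq_zero.2 <|
        eq_zero_of_isUnit_prod (fun x hx => (hs x hx).not_isUnit) (hsa.isUnit_iff.2 ha)⟩
    · obtain ⟨t, htcard, ht, rfl⟩ := exists_irreducible_prod_eq_of_associated hs ha hsa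
      refine Or.inr ⟨ha, Nat.pos_of_ne_zero fun h => ha ?_, t.toList, by simpa using htcard,
        by simpa using ht, t.prod_toList⟩
      rw [Multiset.card_eq_zero.1 (htcard.trans h), Multiset.prod_zero]
      exact isUnit_one

theorem setOfLengths_eq_of_associated {a b : H} (h : Associated a b) :
    setOfLengths a = setOfLengths b := by
  ext k
  simp only [mem_setOfLengths_iff]
  exact ⟨fun ⟨s, hcard, hs, hsa⟩ => ⟨s, hcard, hs, hsa.trans h⟩,
    fun ⟨s, hcard, hs, hsb⟩ => ⟨s, hcard, hs, hsb.trans h.symm⟩⟩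

theorem setOfLengths_of_isUnit {a : H} (ha : IsUnit a) : setOfLengths a = {0} := by
  ext k
  simp [setOfLengths, ha]

theorem pos_of_mem_setOfLengths {a : H} (ha : ¬ IsUnit a) {k : ℕ} (hk : k ∈ setOfLengths a) :
    0 < k := by
  rcases hk with ⟨h, -⟩ | ⟨-, h, -⟩
  exacts [absurd h ha, h]

theorem add_mem_setOfLengths_mul {a b : H} {k l : ℕ} (hk : k ∈ setOfLengths a)
    (hl : l ∈ setOfLengths b) : k + l ∈ setOfLengths (a * b) := by
  obtain ⟨s, rfl, hs, hsa⟩ := mem_setOfLengths_iff.1 hk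
  obtain ⟨t, rfl, ht, htb⟩ := mem_setOfLengths_iff.1 hl
  refine mem_setOfLengths_iff.2 ⟨s + t, s.card_add t, fun x hx => ?_, ?_⟩
  · exact (Multiset.mem_add.1 hx).elim (hs x) (ht x)
  · rw [Multiset.prod_add]
    exact hsa.mul_mul htb

theorem mul_mem_setOfLengths_pow {a : H} {k : ℕ} (hk : k ∈ setOfLengths a) (q : ℕ) :
    q * k ∈ setOfLengths (a ^ q) := by
  induction q with
  | zero => simp [setOfLengths]
  | succ q ih =>
    rw [add_mul, one_mul, pow_succ]
    exact add_mem_setOfLengths_mul ih hk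

theorem mul_add_mul_mem_setOfLengths_pow {a : H} {k d : ℕ} (hk : k ∈ setOfLengths a)
    (hkd : k + d ∈ setOfLengths a) {q i : ℕ} (hi : i ≤ q) :
    q * k + i * d ∈ setOfLengths (a ^ q) := by
  obtain ⟨j, rfl⟩ := Nat.exists_eq_add_of_le hi
  have h := add_mem_setOfLengths_mul (mul_mem_setOfLengths_pow hkd i)
    (mul_mem_setOfLengths_pow hk j)
  rw [← pow_add] at h
  convert h using 1
  ring

theorem one_mem_setOfLengths_iff {u : H} : 1 ∈ setOfLengths u ↔ Irreducible u := by
  rw [mem_setOfLengths_iff]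
  constructor
  · rintro ⟨s, hcard, hs, hsu⟩
    obtain ⟨x, rfl⟩ := Multiset.card_eq_one.1 hcard
    exact hsu.irreducible (by simpa using hs)
  · exact fun hu => ⟨{u}, by simp, by simpa using hu, by simp⟩

theorem setOfLengths_of_irreducible {u : H} (hu : Irreducible u) : setOfLengths u = {1} := by
  refine Set.eq_singleton_iff_unique_mem.2 ⟨one_mem_setOfLengths_iff.2 hu, fun k hk => ?_⟩
  obtain ⟨s, rfl, hs, hsu⟩ := mem_setOfLengths_iff.1 hk
  rcases s.empty_or_exists_mem with rfl | ⟨x, hx⟩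
  · exact absurd (associated_one_iff_isUnit.1 (by simpa using hsu.symm)) hu.not_isUnit
  · obtain ⟨t, rfl⟩ := Multiset.exists_cons_of_mem hx
    rw [Multiset.forall_mem_cons] at hs
    rw [Multiset.prod_cons] at hsu
    have ht : IsUnit t.prod :=
      ((hsu.symm.irreducible hu).isUnit_or_isUnit rfl).resolve_left hs.1.not_isUnit
    simp [eq_zero_of_isUnit_prod (fun y hy => (hs.2 y hy).not_isUnit) ht]

theorem IsAtomicMonoid.setOfLengths_nonempty (hH : IsAtomicMonoid H) (a : H) :
    (setOfLengths a).Nonempty := by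
  by_cases ha : IsUnit a
  · exact ⟨0, Or.inl ⟨ha, rfl⟩⟩
  · obtain ⟨l, hl, rfl⟩ := hH a ha
    exact ⟨_, mem_setOfLengths_iff.2 ⟨l, rfl, by simpa using hl, by simp⟩⟩

theorem IsAtomicMonoid.exists_two_lengths (hH : IsAtomicMonoid H) (hnhf : ¬ IsHalfFactorial H) :
    ∃ (a : H) (k d : ℕ), 0 < d ∧ k ∈ setOfLengths a ∧ k + d ∈ setOfLengths a := by
  simp only [IsHalfFactorial, lengthSystem, Set.forall_mem_range, not_forall] at hnhf
  obtain ⟨a, ha⟩ := hnhf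
  have hnontrivial : (setOfLengths a).Nontrivial := by
    rw [← Set.not_subsingleton_iff]
    exact fun h => ha <| Set.encard_eq_one.2 <|
      h.eq_empty_or_singleton.resolve_left (hH.setOfLengths_nonempty a).ne_empty
  obtain ⟨k, hk, l, hl, hkl⟩ := hnontrivial.exists_lt
  exact ⟨a, k, l - k, by omega, hk, by rwa [Nat.add_sub_cancel' hkl.le]⟩

theorem isAtomicMonoid_of_bounded_nonunit_products
    (h : ∀ a : H, ¬ IsUnit a → ∃ N : ℕ, ∀ s : Multiset H, (∀ x ∈ s, ¬ IsUnit x) →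
      s.prod = a → s.card ≤ N) : IsAtomicMonoid H := by
  intro a ha
  obtain ⟨N, hN⟩ := h a ha
  let lengths : Set ℕ := {n | ∃ s : Multiset H, (∀ x ∈ s, ¬ IsUnit x) ∧ s.prod = a ∧ s.card = n}
  have hbdd : BddAbove lengths := by
    refine ⟨N, ?_⟩
    rintro _ ⟨s, hs, hsa, rfl⟩
    exact hN s hs hsa
  obtain ⟨s, hs, hsa, hcard⟩ : sSup lengths ∈ lengths :=
    Nat.sSup_mem ⟨1, {a}, by simpa using ha, by simp, by simp⟩ hbdd
  have hmax : ∀ t : Multiset H, (∀ x ∈ t, ¬ IsUnit x) → t.prod = a → t.card ≤ s.card :=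
    fun t ht hta => hcard ▸ le_csSup hbdd ⟨t, ht, hta, rfl⟩
  refine ⟨s.toList, fun x hx => ⟨hs x (by simpa using hx), fun {y z} hyz => ?_⟩, by simpa⟩
  by_contra! hcon
  obtain ⟨t, rfl⟩ := Multiset.exists_cons_of_mem (Multiset.mem_toList.1 hx)
  rw [Multiset.forall_mem_cons] at hs
  have hle := hmax (y ::ₘ z ::ₘ t) (by simpa [hcon] using hs.2)
    (by rw [← hsa, hyz]; simp [mul_assoc])
  simp at hle

end Lengths

section Distances

theorem exists_consecutive {A : Set ℕ} {p q x : ℕ} (hp : p ∈ A) (hq : q ∈ A) (hpx : p ≤ x)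
    (hxq : x < q) : ∃ l ∈ A, ∃ r ∈ A, l ≤ x ∧ x < r ∧ ∀ c ∈ A, c ≤ l ∨ r ≤ c := by
  classical
  have hne : {c | c ∈ A ∧ x < c}.Nonempty := ⟨q, hq, hxq⟩
  refine ⟨Nat.findGreatest (· ∈ A) x, Nat.findGreatest_spec (P := (· ∈ A)) hpx hp,
    sInf {c | c ∈ A ∧ x < c}, (Nat.sInf_mem hne).1, Nat.findGreatest_le x,
    (Nat.sInf_mem hne).2, fun c hc => ?_⟩
  rcases le_or_gt c x with h | h
  · exact Or.inl (Nat.le_findGreatest h hc)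
  · exact Or.inr (Nat.sInf_le ⟨hc, h⟩)

theorem sub_mem_distances {A : Set ℕ} {l r : ℕ} (hl : l ∈ A) (hr : r ∈ A) (hlr : l < r)
    (h : ∀ c ∈ A, c ≤ l ∨ r ≤ c) : r - l ∈ distances A := by
  refine ⟨Nat.sub_pos_of_lt hlr, l, hl, by rwa [Nat.add_sub_cancel' hlr.le], fun c hc hcon => ?_⟩
  have := h c hc
  omega

theorem exists_distance_le {A : Set ℕ} {p q : ℕ} (hp : p ∈ A) (hq : q ∈ A) (hpq : p < q) :
    ∃ d ∈ distances A, d ≤ q - p := by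
  obtain ⟨l, hl, r, hr, hlp, hpr, hlr⟩ := exists_consecutive hp hq le_rfl hpq
  refine ⟨r - l, sub_mem_distances hl hr (hlp.trans_lt hpr) hlr, ?_⟩
  have := hlr p hp
  have := hlr q hq
  omega

variable {H : Type u} [CommMonoid H]

theorem mem_distanceSet {d : ℕ} :
    d ∈ distanceSet H ↔ ∃ a : H, d ∈ distances (setOfLengths a) := by
  simp [distanceSet, lengthSystem]

theorem IsAtomicMonoid.distanceSet_nonempty (hH : IsAtomicMonoid H)
    (hnhf : ¬ IsHalfFactorial H) : (distanceSet H).Nonempty := by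
  obtain ⟨a, k, d, hd, hk, hkd⟩ := hH.exists_two_lengths hnhf
  obtain ⟨d', hd', -⟩ := exists_distance_le hk hkd (Nat.lt_add_of_pos_right hd)
  exact ⟨d', mem_distanceSet.2 ⟨a, hd'⟩⟩

variable (H) in
/-- The differences of two lengths of a common element of `H`. They form the subgroup of `ℤ`
generated by the set of distances of `H`. -/
def lengthDifferences : AddSubgroup ℤ where
  carrier := {e | ∃ a : H, ∃ k ∈ setOfLengths a, ∃ l ∈ setOfLengths a, (l : ℤ) - k = e}
  zero_mem' := ⟨1, 0, by simp [setOfLengths], 0, by simp [setOfLengths], by simp⟩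
  add_mem' := by
    rintro _ _ ⟨a, k, hk, l, hl, rfl⟩ ⟨b, k', hk', l', hl', rfl⟩
    exact ⟨a * b, _, add_mem_setOfLengths_mul hk hk', _, add_mem_setOfLengths_mul hl hl',
      by push_cast; ring⟩
  neg_mem' := by
    rintro _ ⟨a, k, hk, l, hl, rfl⟩
    exact ⟨a, l, hl, k, hk, by ring⟩

theorem isLeast_sInf_distanceSet (hne : (distanceSet H).Nonempty) :
    IsLeast {e | e ∈ lengthDifferences H ∧ 0 < e} ((sInf (distanceSet H) : ℕ) : ℤ) := by
  constructor
  · obtain ⟨a, hd, k, hk, hkd, -⟩ := mem_distanceSet.1 (Nat.sInf_mem hne)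
    exact ⟨⟨a, k, hk, _, hkd, by push_cast; ring⟩, by exact_mod_cast hd⟩
  · rintro _ ⟨⟨a, k, hk, l, hl, rfl⟩, hpos⟩
    obtain ⟨d, hd, hle⟩ := exists_distance_le hk hl (by omega)
    have : sInf (distanceSet H) ≤ d := Nat.sInf_le (mem_distanceSet.2 ⟨a, hd⟩)
    omega

theorem sInf_distanceSet_dvd_sub (hne : (distanceSet H).Nonempty) {a : H} {k l : ℕ}
    (hk : k ∈ setOfLengths a) (hl : l ∈ setOfLengths a) :
    ((sInf (distanceSet H) : ℕ) : ℤ) ∣ (l : ℤ) - k := by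
  have hmem : (l : ℤ) - k ∈ lengthDifferences H := ⟨a, k, hk, l, hl, rfl⟩
  rwa [AddSubgroup.cyclic_of_min (isLeast_sInf_distanceSet hne),
    ← AddSubgroup.zmultiples_eq_closure, Int.mem_zmultiples_iff] at hmem

end Distances

section StronglyPrimary

variable {H : Type u} [CancelCommMonoid H]

namespace IsStronglyPrimary

theorem primaryExponent_spec (hH : IsStronglyPrimary H) (a : H) :
    0 < primaryExponent a ∧ nonunits H ^ primaryExponent a ⊆ {x | a ∣ x} := by
  refine Nat.sInf_mem (s := {n : ℕ | 0 < n ∧ nonunits H ^ n ⊆ {x | a ∣ x}}) ?_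
  by_cases ha : IsUnit a
  · exact ⟨1, one_pos, fun x _ => ha.dvd⟩
  · exact hH.2 a ha

theorem primaryExponent_pos (hH : IsStronglyPrimary H) (a : H) : 0 < primaryExponent a :=
  (hH.primaryExponent_spec a).1

theorem dvd_prod_of_card_eq (hH : IsStronglyPrimary H) {a : H} {s : Multiset H}
    (hs : ∀ x ∈ s, ¬ IsUnit x) (h : s.card = primaryExponent a) : a ∣ s.prod := by
  have hmem := Set.multiset_prod_mem_multiset_prod s (fun _ => nonunits H) id hs
  rw [Multiset.map_id, Multiset.map_const', Multiset.prod_replicate, h] at hmem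
  exact (hH.primaryExponent_spec a).2 hmem

theorem pow_dvd_prod (hH : IsStronglyPrimary H) {a : H} {q : ℕ} {s : Multiset H}
    (hs : ∀ x ∈ s, ¬ IsUnit x) (h : q * primaryExponent a ≤ s.card) : a ^ q ∣ s.prod := by
  induction q generalizing s with
  | zero => simp
  | succ q ih =>
    rw [add_mul, one_mul] at h
    obtain ⟨t, hts, ht⟩ := exists_le_card_eq ((Nat.le_add_left _ _).trans h)
    obtain ⟨r, rfl⟩ := Multiset.le_iff_exists_add.1 hts
    rw [Multiset.card_add] at h
    rw [Multiset.prod_add, pow_succ']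
    exact mul_dvd_mul (hH.dvd_prod_of_card_eq (fun x hx => hs x (by simp [hx])) ht)
      (ih (fun x hx => hs x (by simp [hx])) (by omega))

theorem dvd_prod (hH : IsStronglyPrimary H) {a : H} {s : Multiset H}
    (hs : ∀ x ∈ s, ¬ IsUnit x) (h : primaryExponent a ≤ s.card) : a ∣ s.prod := by
  simpa using hH.pow_dvd_prod (q := 1) hs (by simpa using h)

theorem pow_dvd_of_mem_setOfLengths (hH : IsStronglyPrimary H) {a b : H} {q k : ℕ}
    (hk : k ∈ setOfLengths b) (h : q * primaryExponent a ≤ k) : a ^ q ∣ b := by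
  obtain ⟨s, rfl, hs, hsb⟩ := mem_setOfLengths_iff.1 hk
  exact (hH.pow_dvd_prod (fun x hx => (hs x hx).not_isUnit) h).trans hsb.dvd

theorem dvd_of_mem_setOfLengths (hH : IsStronglyPrimary H) {a b : H} {k : ℕ}
    (hk : k ∈ setOfLengths b) (h : primaryExponent a ≤ k) : a ∣ b := by
  simpa using hH.pow_dvd_of_mem_setOfLengths (q := 1) hk (by simpa using h)

theorem card_le_primaryExponent (hH : IsStronglyPrimary H) {a : H} {s : Multiset H}
    (hs : ∀ x ∈ s, ¬ IsUnit x) (h : s.prod ∣ a) : s.card ≤ primaryExponent a := by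
  by_contra! hlt
  obtain ⟨x, hx⟩ := Multiset.card_pos_iff_exists_mem.1 (Nat.zero_lt_of_lt hlt)
  obtain ⟨t, rfl⟩ := Multiset.exists_cons_of_mem hx
  rw [Multiset.card_cons, Nat.lt_succ_iff] at hlt
  have hat : a ∣ t.prod := hH.dvd_prod (fun y hy => hs y (by simp [hy])) hlt
  obtain ⟨c, hc⟩ := h.trans hat
  rw [Multiset.prod_cons, mul_comm x, mul_assoc, left_eq_mul] at hc
  exact hs x hx (IsUnit.of_mul_eq_one c hc)

theorem le_primaryExponent_of_mem_setOfLengths (hH : IsStronglyPrimary H) {a : H} {k : ℕ}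
    (hk : k ∈ setOfLengths a) : k ≤ primaryExponent a := by
  obtain ⟨s, rfl, hs, hsa⟩ := mem_setOfLengths_iff.1 hk
  exact hH.card_le_primaryExponent (fun x hx => (hs x hx).not_isUnit) hsa.dvd

theorem isAtomicMonoid (hH : IsStronglyPrimary H) : IsAtomicMonoid H :=
  isAtomicMonoid_of_bounded_nonunit_products fun a _ =>
    ⟨primaryExponent a, fun _ hs hsa => hH.card_le_primaryExponent hs hsa.dvd⟩

theorem setOfLengths_nonempty (hH : IsStronglyPrimary H) (a : H) : (setOfLengths a).Nonempty :=
  hH.isAtomicMonoid.setOfLengths_nonempty a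

theorem exists_isGreatest_setOfLengths (hH : IsStronglyPrimary H) (a : H) :
    ∃ N, IsGreatest (setOfLengths a) N :=
  BddAbove.exists_isGreatest_of_nonempty
    ⟨primaryExponent a, fun _ hk => hH.le_primaryExponent_of_mem_setOfLengths hk⟩
    (hH.setOfLengths_nonempty a)

theorem exists_irreducible (hH : IsStronglyPrimary H) : ∃ u : H, Irreducible u := by
  obtain ⟨a, ha⟩ := hH.1
  obtain ⟨l, hl, rfl⟩ := hH.isAtomicMonoid a ha
  cases l with
  | nil => simp at ha
  | cons x l => exact ⟨x, hl x (by simp)⟩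

theorem finiteMultiplicity (hH : IsStronglyPrimary H) {a : H} (ha : ¬ IsUnit a) (b : H) :
    FiniteMultiplicity a b := by
  refine ⟨primaryExponent b, fun h => ?_⟩
  rw [← Multiset.prod_replicate] at h
  have hcard := hH.card_le_primaryExponent
    (fun x hx => (Multiset.eq_of_mem_replicate hx).symm ▸ ha) h
  simp at hcard

end IsStronglyPrimary

end StronglyPrimary

section Elasticity

theorem elasticity_singleton (n : ℕ) : elasticity {n} = 1 := by
  rw [elasticity]
  split_ifs with h
  · rfl
  · have hn : (n : ℝ≥0∞) ≠ 0 := fun h0 => h (by rw [Nat.cast_eq_zero.1 h0])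
    simp [ENNReal.div_self hn]

theorem natCast_div_le_elasticity {A : Set ℕ} {m n : ℕ} (hm : IsLeast A m) (hm₀ : 0 < m)
    (hn : n ∈ A) : (n : ℝ≥0∞) / (m : ℝ≥0∞) ≤ elasticity A := by
  have hA : A ≠ {0} := by
    rintro rfl
    exact hm₀.ne' hm.1
  rw [elasticity, if_neg hA, hm.csInf_eq]
  exact ENNReal.div_le_div_right (le_iSup₂ (f := fun (n : ℕ) (_ : n ∈ A) => (n : ℝ≥0∞)) n hn) _

theorem ofReal_le_elasticity {A : Set ℕ} {m n c : ℕ} (hm : IsLeast A m) (hm₀ : 0 < m)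
    (hn : n ∈ A) (hc : m ≤ c * (n - m)) :
    ENNReal.ofReal (1 + 1 / c) ≤ elasticity A := by
  refine le_trans ?_ (natCast_div_le_elasticity hm hm₀ hn)
  rw [← ENNReal.ofReal_natCast n, ← ENNReal.ofReal_natCast m,
    ← ENNReal.ofReal_div_of_pos (by exact_mod_cast hm₀)]
  refine ENNReal.ofReal_le_ofReal ?_
  have hc₀ : (0 : ℝ) < c := by
    exact_mod_cast Nat.pos_of_ne_zero fun h => by simp [h] at hc; omega
  have hm₀' : (0 : ℝ) < m := by exact_mod_cast hm₀
  have hc' : (m : ℝ) ≤ c * (n - m) := by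
    rw [← Nat.cast_sub (hm.2 hn)]
    exact_mod_cast hc
  rw [one_add_div hc₀.ne', div_le_div_iff₀ hc₀ hm₀']
  linarith

variable {H : Type u} [CancelCommMonoid H]

theorem IsStronglyPrimary.exists_length_spread (hH : IsStronglyPrimary H) {a : H} {k d : ℕ}
    (hd : 0 < d) (hk : k ∈ setOfLengths a) (hkd : k + d ∈ setOfLengths a) {b : H} {N : ℕ}
    (hN : N ∈ setOfLengths b) :
    ∃ l ∈ setOfLengths b, ∃ l' ∈ setOfLengths b, l + N / primaryExponent a ≤ l' := by
  set q := N / primaryExponent a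
  obtain ⟨c, rfl⟩ := hH.pow_dvd_of_mem_setOfLengths hN (Nat.div_mul_le_self N (primaryExponent a))
  obtain ⟨l, hl⟩ := hH.setOfLengths_nonempty c
  refine ⟨_, add_mem_setOfLengths_mul (mul_mem_setOfLengths_pow hk q) hl,
    _, add_mem_setOfLengths_mul (mul_mem_setOfLengths_pow hkd q) hl, ?_⟩
  linarith [Nat.le_mul_of_pos_right q hd, mul_add q k d]

theorem IsStronglyPrimary.min_le_mul_max_sub_min (hH : IsStronglyPrimary H) {a : H} {k d : ℕ}
    (hd : 0 < d) (hk : k ∈ setOfLengths a) (hkd : k + d ∈ setOfLengths a) {b : H} {m N : ℕ}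
    (hm : IsLeast (setOfLengths b) m) (hN : IsGreatest (setOfLengths b) N) (hmN : m < N) :
    m ≤ 2 * primaryExponent a * (N - m) := by
  set n := primaryExponent a with hn
  obtain ⟨l, hl, l', hl', hll'⟩ := hH.exists_length_spread hd hk hkd hN.1
  have hq : N / n + 1 ≤ 2 * (N - m) := by
    have hml := hm.2 hl
    have hlN := hN.2 hl'
    rw [← hn] at hll'
    omega
  calc m ≤ N := hmN.le
    _ ≤ n * (N / n + 1) := (Nat.lt_mul_div_succ N (hH.primaryExponent_pos a)).le
    _ ≤ n * (2 * (N - m)) := Nat.mul_le_mul_left _ hq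
    _ = 2 * n * (N - m) := by ring

theorem IsStronglyPrimary.exists_elasticity_gap (hH : IsStronglyPrimary H)
    (hnhf : ¬ IsHalfFactorial H) :
    ∃ β : ℚ, 1 < β ∧
      ∀ L ∈ lengthSystem H, elasticity L ≠ 1 → ENNReal.ofReal (β : ℝ) ≤ elasticity L := by
  obtain ⟨a, k, d, hd, hk, hkd⟩ := hH.isAtomicMonoid.exists_two_lengths hnhf
  refine ⟨1 + 1 / (2 * primaryExponent a : ℕ), by simpa using hH.primaryExponent_pos a, ?_⟩
  rintro _ ⟨b, rfl⟩ hb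
  have hbu : ¬ IsUnit b := fun hu => hb (by rw [setOfLengths_of_isUnit hu, elasticity_singleton])
  have hm := isLeast_csInf (hH.setOfLengths_nonempty b)
  obtain ⟨N, hN⟩ := hH.exists_isGreatest_setOfLengths b
  have hmN : sInf (setOfLengths b) < N := by
    refine (hm.2 hN.1).lt_of_ne fun h => hb ?_
    rw [Set.eq_singleton_iff_unique_mem.2
      ⟨hN.1, fun l hl => le_antisymm (hN.2 hl) (h ▸ hm.2 hl)⟩, elasticity_singleton]
  have hgap := ofReal_le_elasticity hm (pos_of_mem_setOfLengths hbu hm.1) hN.1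
    (hH.min_le_mul_max_sub_min hd hk hkd hm hN hmN)
  push_cast at hgap ⊢
  exact hgap

theorem IsStronglyPrimary.exists_singleton_notMem_lengthSystem (hH : IsStronglyPrimary H)
    (hnhf : ¬ IsHalfFactorial H) : ∃ k : ℕ, {k} ∉ lengthSystem H := by
  obtain ⟨a, k, d, hd, hk, hkd⟩ := hH.isAtomicMonoid.exists_two_lengths hnhf
  refine ⟨primaryExponent a, ?_⟩
  rintro ⟨b, hb⟩
  obtain ⟨c, rfl⟩ := hH.dvd_of_mem_setOfLengths (hb ▸ Set.mem_singleton _) le_rfl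
  obtain ⟨l, hl⟩ := hH.setOfLengths_nonempty c
  have hkl := add_mem_setOfLengths_mul hk hl
  have hkdl := add_mem_setOfLengths_mul hkd hl
  rw [hb, Set.mem_singleton_iff] at hkl hkdl
  omega

end Elasticity

section AbsolutelyIrreducible

variable {M : Type u} [CommMonoid M]

/-- An atom `u` is absolutely irreducible if, up to units, it is the only atom dividing a power
of `u`. In a cancellative monoid the powers of `u` then factor uniquely. -/
def IsAbsolutelyIrreducible (u : M) : Prop :=
  Irreducible u ∧ ∀ (n : ℕ) (v : M), Irreducible v → v ∣ u ^ n → Associated v u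

theorem le_of_pow_dvd_pow [IsCancelMul M] {u : M} (hu : ¬ IsUnit u) {m n : ℕ}
    (h : u ^ m ∣ u ^ n) : m ≤ n := by
  by_contra! hlt
  obtain ⟨j, rfl⟩ := Nat.exists_eq_add_of_lt hlt
  obtain ⟨c, hc⟩ := h
  rw [add_assoc, pow_add, mul_assoc, left_eq_mul, pow_succ', mul_assoc] at hc
  exact hu (IsUnit.of_mul_eq_one _ hc)

theorem IsAbsolutelyIrreducible.setOfLengths_pow [IsCancelMul M] {u : M}
    (hu : IsAbsolutelyIrreducible u) (k : ℕ) : setOfLengths (u ^ k) = {k} := by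
  refine Set.eq_singleton_iff_unique_mem.2 ⟨?_, fun l hl => ?_⟩
  · simpa using mul_mem_setOfLengths_pow (one_mem_setOfLengths_iff.2 hu.1) k
  · obtain ⟨s, rfl, hs, hsu⟩ := mem_setOfLengths_iff.1 hl
    have hpow : Associated s.prod (u ^ s.card) := by
      have hassoc : ∀ x ∈ s, Associated x u := fun x hx =>
        hu.2 k x (hs x hx) ((Multiset.dvd_prod hx).trans hsu.dvd)
      clear hl hs hsu
      induction s using Multiset.induction_on with
      | empty => simp
      | cons x t ih =>
        rw [Multiset.forall_mem_cons] at hassoc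
        rw [Multiset.prod_cons, Multiset.card_cons, pow_succ']
        exact hassoc.1.mul_mul (ih hassoc.2)
    have huk : Associated (u ^ s.card) (u ^ k) := hpow.symm.trans hsu
    exact le_antisymm (le_of_pow_dvd_pow hu.1.not_isUnit huk.dvd)
      (le_of_pow_dvd_pow hu.1.not_isUnit huk.symm.dvd)

end AbsolutelyIrreducible

section Krull

variable {α : Type v}

/-- A submonoid of a free abelian monoid is saturated if it is closed under those quotients
that exist in the free monoid. Up to units, these submonoids are the Krull monoids. -/
def IsSaturated (S : AddSubmonoid (Multiset α)) : Prop :=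
  ∀ x ∈ S, ∀ y, x + y ∈ S → y ∈ S

open Classical in
theorem exists_count_nsmul_le (x : Multiset α) {u : Multiset α} (hu : u ≠ 0) :
    ∃ g ∈ u, x.count g • u ≤ u.count g • x := by
  obtain ⟨g, hg, hmin⟩ := Finset.exists_min_image u.toFinset
    (fun h => (x.count h : ℚ) / u.count h) (Multiset.toFinset_nonempty.2 hu)
  refine ⟨g, Multiset.mem_toFinset.1 hg, Multiset.le_iff_count.2 fun h => ?_⟩
  rw [Multiset.count_nsmul, Multiset.count_nsmul]
  by_cases hh : h ∈ u
  · have hratio := hmin h (Multiset.mem_toFinset.2 hh)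
    rw [div_le_div_iff₀ (by exact_mod_cast Multiset.count_pos.2 (Multiset.mem_toFinset.1 hg))
      (by exact_mod_cast Multiset.count_pos.2 hh)] at hratio
    rw [mul_comm (u.count g)]
    exact_mod_cast hratio
  · simp [Multiset.count_eq_zero.2 hh]

namespace IsSaturated

variable {S : AddSubmonoid (Multiset α)}

theorem exists_nsmul_eq_nsmul (hS : IsSaturated S) {u : Multiset α} (hu : u ∈ S) (hu₀ : u ≠ 0)
    (hmin : ∀ x ∈ S, x ≠ 0 → x ⊆ u → u ⊆ x) {x : Multiset α} (hx : x ∈ S) (hxu : x ⊆ u) :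
    ∃ p q : ℕ, 0 < q ∧ p • u = q • x := by
  classical
  obtain ⟨g, hg, hle⟩ := exists_count_nsmul_le x hu₀
  obtain ⟨w, hw⟩ := Multiset.le_iff_exists_add.1 hle
  have hwS : w ∈ S := hS _ (S.nsmul_mem hu _) w (hw ▸ S.nsmul_mem hx _)
  have hgw : g ∉ w := by
    have hcount := congrArg (Multiset.count g) hw
    rw [Multiset.count_add, Multiset.count_nsmul, Multiset.count_nsmul, mul_comm,
      left_eq_add] at hcount
    exact Multiset.count_eq_zero.1 hcount
  have hwu : w ⊆ u := fun h hh =>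
    hxu (Multiset.mem_of_mem_nsmul (hw ▸ Multiset.mem_add.2 (Or.inr hh)))
  have hw₀ : w = 0 := by
    by_contra hw₀
    exact hgw (hmin w hwS hw₀ hwu hg)
  exact ⟨x.count g, u.count g, Multiset.count_pos.2 hg, by rw [hw, hw₀, add_zero]⟩

theorem exists_le_of_subset (hS : IsSaturated S) (hne : ∃ x ∈ S, x ≠ 0) :
    ∃ u ∈ S, u ≠ 0 ∧ ∀ x ∈ S, x ≠ 0 → x ⊆ u → u ≤ x := by
  classical
  obtain ⟨v, ⟨hvS, hv₀⟩, hvmin⟩ := exists_minimalFor_of_wellFoundedLT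
    (fun x => x ∈ S ∧ x ≠ 0) (fun x : Multiset α => x.toFinset.card) hne
  have hvsupp : ∀ x ∈ S, x ≠ 0 → x ⊆ v → v ⊆ x := fun x hx hx₀ hxv => by
    have hsub := Multiset.toFinset_subset.2 hxv
    rw [← Multiset.toFinset_subset, Finset.eq_of_subset_of_card_le hsub
      (hvmin ⟨hx, hx₀⟩ (Finset.card_le_card hsub))]
  obtain ⟨u, ⟨huS, hu₀, huv⟩, humin⟩ := exists_minimalFor_of_wellFoundedLT
    (fun x => x ∈ S ∧ x ≠ 0 ∧ x ⊆ v) Multiset.card ⟨v, hvS, hv₀, .refl v⟩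
  refine ⟨u, huS, hu₀, fun x hx hx₀ hxu => ?_⟩
  have husupp : ∀ y ∈ S, y ≠ 0 → y ⊆ u → u ⊆ y := fun y hy hy₀ hyu =>
    Multiset.Subset.trans huv (hvsupp y hy hy₀ (Multiset.Subset.trans hyu huv))
  obtain ⟨p, q, hq, hpq⟩ := hS.exists_nsmul_eq_nsmul huS hu₀ husupp hx hxu
  have hcard : u.card ≤ x.card :=
    (le_total u.card x.card).elim id (humin ⟨hx, hx₀, Multiset.Subset.trans hxu huv⟩)
  have hqp : q ≤ p := by
    have hcards : p * u.card = q * x.card := by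
      simpa using congrArg Multiset.card hpq
    exact Nat.le_of_mul_le_mul_right (hcards ▸ Nat.mul_le_mul_left q hcard)
      (Multiset.card_pos.2 hu₀)
  refine Multiset.le_iff_count.2 fun h => Nat.le_of_mul_le_mul_left ?_ hq
  calc q * u.count h ≤ p * u.count h := Nat.mul_le_mul_right _ hqp
    _ = q * x.count h := by simpa using congrArg (Multiset.count h) hpq

theorem dvd_iff_le (hS : IsSaturated S) {x y : Multiplicative S} :
    x ∣ y ↔ (x.toAdd : Multiset α) ≤ y.toAdd := by
  rw [Multiset.le_iff_exists_add]
  constructor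
  · rintro ⟨z, rfl⟩
    exact ⟨z.toAdd, rfl⟩
  · rintro ⟨z, hz⟩
    exact ⟨.ofAdd ⟨z, hS _ x.toAdd.2 z (hz ▸ y.toAdd.2)⟩, Subtype.ext hz⟩

theorem isUnit_iff (hS : IsSaturated S) {x : Multiplicative S} :
    IsUnit x ↔ (x.toAdd : Multiset α) = 0 := by
  rw [isUnit_iff_dvd_one, hS.dvd_iff_le]
  exact Multiset.le_zero

theorem exists_isAbsolutelyIrreducible (hS : IsSaturated S) (hne : ∃ x ∈ S, x ≠ 0) :
    ∃ u : Multiplicative S, IsAbsolutelyIrreducible u := by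
  obtain ⟨u, huS, hu₀, hmin⟩ := hS.exists_le_of_subset hne
  have hdvd : ∀ (n : ℕ) (v : Multiplicative S), ¬ IsUnit v →
      v ∣ (.ofAdd ⟨u, huS⟩ : Multiplicative S) ^ n → .ofAdd ⟨u, huS⟩ ∣ v := by
    intro n v hv hvu
    rw [hS.dvd_iff_le] at hvu ⊢
    exact hmin _ v.toAdd.2 (mt hS.isUnit_iff.2 hv) fun g hg =>
      Multiset.mem_of_mem_nsmul (n := n) (Multiset.mem_of_le hvu hg)
  refine ⟨.ofAdd ⟨u, huS⟩, ⟨mt hS.isUnit_iff.1 hu₀, fun {x y} hxy => ?_⟩, fun n v hv hvu => ?_⟩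
  · refine or_iff_not_imp_left.2 fun hx => ?_
    obtain ⟨c, hc⟩ := hdvd 1 x hx (by simp [hxy])
    rw [hxy, mul_assoc, left_eq_mul] at hc
    exact IsUnit.of_mul_eq_one c hc
  · exact (hv.dvd_iff.1 (hdvd n v hv.not_isUnit hvu)).resolve_left (mt hS.isUnit_iff.1 hu₀)

theorem singleton_mem_lengthSystem (hS : IsSaturated S) {x : Multiplicative S}
    (hx : ¬ IsUnit x) (k : ℕ) : {k} ∈ lengthSystem (Multiplicative S) := by
  obtain ⟨u, hu⟩ := hS.exists_isAbsolutelyIrreducible ⟨_, x.toAdd.2, mt hS.isUnit_iff.2 hx⟩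
  exact ⟨u ^ k, hu.setOfLengths_pow k⟩

end IsSaturated

theorem mem_zeroSumSequences {G : Type v} [AddCommGroup G] {G₀ : Set G} {x : Multiset G₀} :
    x ∈ zeroSumSequences G₀ ↔ (x.map (fun g : G₀ => (g : G))).sum = 0 :=
  Iff.rfl

theorem isSaturated_zeroSumSequences {G : Type v} [AddCommGroup G] (G₀ : Set G) :
    IsSaturated (zeroSumSequences G₀) := by
  intro x hx y hxy
  rw [mem_zeroSumSequences] at hx hxy ⊢
  rwa [Multiset.map_add, Multiset.sum_add, hx, zero_add] at hxy

theorem IsStronglyPrimary.lengthSystem_ne_of_isSaturated {H : Type u} [CancelCommMonoid H]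
    (hH : IsStronglyPrimary H) (hnhf : ¬ IsHalfFactorial H) {S : AddSubmonoid (Multiset α)}
    (hS : IsSaturated S) : lengthSystem H ≠ lengthSystem (Multiplicative S) := by
  intro heq
  obtain ⟨k, hk⟩ := hH.exists_singleton_notMem_lengthSystem hnhf
  obtain ⟨u, hu⟩ := hH.exists_irreducible
  obtain ⟨x, hx⟩ : {1} ∈ lengthSystem (Multiplicative S) :=
    heq ▸ ⟨u, setOfLengths_of_irreducible hu⟩
  have hxu : ¬ IsUnit x := fun h => by simp [setOfLengths_of_isUnit h] at hx
  exact hk (heq ▸ hS.singleton_mem_lengthSystem hxu k)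

end Krull

section TransferHomomorphisms

namespace IsWeakTransferHom

variable {H : Type u} {B : Type v} [CommMonoid B]

theorem setOfLengths_map_subset [Monoid H] {θ : H →* B} (hθ : IsWeakTransferHom θ) (a : H) :
    setOfLengths (θ a) ⊆ setOfLengths a := by
  rintro k (⟨ha, rfl⟩ | ⟨ha, hk, l, rfl, hl, hla⟩)
  · exact Or.inl ⟨(hθ.isUnit_iff a).1 ha, rfl⟩
  · obtain ⟨x, -, hx, hax, -⟩ := hθ.lift a l.length hk l.get
      (fun i => hl _ (l.get_mem i)) (by rw [List.ofFn_get, hla])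
    exact Or.inr ⟨mt (hθ.isUnit_iff a).2 ha, hk, List.ofFn x, List.length_ofFn,
      List.forall_mem_ofFn_iff.2 hx, hax.symm⟩

variable [CommMonoid H] {θ : H →* B}

theorem map_irreducible (hθ : IsWeakTransferHom θ) {x : H} (hx : Irreducible x) :
    Irreducible (θ x) := by
  obtain ⟨k, hk⟩ := hθ.atomic.setOfLengths_nonempty (θ x)
  have hk₁ := hθ.setOfLengths_map_subset x hk
  rw [setOfLengths_of_irreducible hx, Set.mem_singleton_iff] at hk₁
  exact one_mem_setOfLengths_iff.1 (hk₁ ▸ hk)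

theorem setOfLengths_map (hθ : IsWeakTransferHom θ) (a : H) :
    setOfLengths (θ a) = setOfLengths a := by
  refine (hθ.setOfLengths_map_subset a).antisymm fun k hk => ?_
  obtain ⟨s, rfl, hs, hsa⟩ := mem_setOfLengths_iff.1 hk
  refine mem_setOfLengths_iff.2 ⟨s.map θ, s.card_map θ, ?_, ?_⟩
  · intro y hy
    obtain ⟨x, hx, rfl⟩ := Multiset.mem_map.1 hy
    exact hθ.map_irreducible (hs x hx)
  · rw [← map_multiset_prod]
    exact hsa.map θ

theorem lengthSystem_eq (hθ : IsWeakTransferHom θ) : lengthSystem H = lengthSystem B := by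
  apply Set.Subset.antisymm
  · rintro _ ⟨a, rfl⟩
    exact ⟨θ a, hθ.setOfLengths_map a⟩
  · rintro _ ⟨b, rfl⟩
    obtain ⟨ε, η, a, rfl⟩ := hθ.surj b
    refine ⟨a, ?_⟩
    rw [← hθ.setOfLengths_map a]
    exact setOfLengths_eq_of_associated ⟨ε * η, by push_cast; ac_rfl⟩

end IsWeakTransferHom

theorem IsStronglyPrimary.not_isTransferKrull {H : Type u} [CancelCommMonoid H]
    (hH : IsStronglyPrimary H) (hnhf : ¬ IsHalfFactorial H) : ¬ IsTransferKrull.{u, v} H := by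
  rintro ⟨G, _, G₀, θ, hθ⟩
  exact hH.lengthSystem_ne_of_isSaturated hnhf (isSaturated_zeroSumSequences G₀)
    hθ.lengthSystem_eq

end TransferHomomorphisms

section Factorizations

theorem irreducible_associatesMk_iff {M : Type u} [CommMonoid M] {a : M} :
    Irreducible (Associates.mk a) ↔ Irreducible a := by
  constructor
  · refine fun h => ⟨mt Associates.isUnit_mk.2 h.not_isUnit, fun {x y} hxy => ?_⟩
    rw [hxy, ← Associates.mk_mul_mk] at h
    simpa only [Associates.isUnit_mk] using h.isUnit_or_isUnit rfl
  · refine fun h => ⟨mt Associates.isUnit_mk.1 h.not_isUnit, fun {p q} hpq => ?_⟩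
    obtain ⟨x, rfl⟩ := Associates.mk_surjective p
    obtain ⟨y, rfl⟩ := Associates.mk_surjective q
    rw [Associates.mk_mul_mk, Associates.mk_eq_mk_iff_associated] at hpq
    simpa only [Associates.isUnit_mk] using (hpq.irreducible h).isUnit_or_isUnit rfl

variable {H : Type u} [CancelCommMonoid H]

theorem associated_of_mul_left_cancel {a b c : H} (h : Associated (a * b) (a * c)) :
    Associated b c := by
  obtain ⟨w, hw⟩ := h
  exact ⟨w, mul_left_cancel ((mul_assoc a b w).symm.trans hw)⟩

theorem dvd_of_mul_dvd_mul_left {a b c : H} (h : a * b ∣ a * c) : b ∣ c := by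
  obtain ⟨d, hd⟩ := h
  exact ⟨d, mul_left_cancel (hd.trans (mul_assoc a b d))⟩

/-- The factorization homomorphism, which multiplies out a formal product of atoms of the reduced
monoid `Associates H`. -/
def factorizationValue (z : Factorization H) : Associates H :=
  (z.map (fun p : {p : Associates H // Irreducible p} => (p : Associates H))).prod

theorem mem_factorizations_iff {a : H} {z : Factorization H} :
    z ∈ factorizations a ↔ factorizationValue z = Associates.mk a :=
  Iff.rfl

theorem factorizationValue_add (z z' : Factorization H) :
    factorizationValue (z + z') = factorizationValue z * factorizationValue z' := by
  simp [factorizationValue]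

theorem add_mem_factorizations_mul {a b : H} {z z' : Factorization H} (hz : z ∈ factorizations a)
    (hz' : z' ∈ factorizations b) : z + z' ∈ factorizations (a * b) := by
  rw [mem_factorizations_iff] at hz hz' ⊢
  rw [factorizationValue_add, hz, hz', Associates.mk_mul_mk]

theorem exists_mul_eq_of_add_mem_factorizations {a : H} {z z' : Factorization H}
    (h : z + z' ∈ factorizations a) :
    ∃ b c, z ∈ factorizations b ∧ z' ∈ factorizations c ∧ b * c = a := by
  obtain ⟨b, hb⟩ := Associates.mk_surjective (factorizationValue z)
  obtain ⟨c, hc⟩ := Associates.mk_surjective (factorizationValue z')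
  rw [mem_factorizations_iff, factorizationValue_add, ← hb, ← hc, Associates.mk_mul_mk,
    Associates.mk_eq_mk_iff_associated] at h
  obtain ⟨w, rfl⟩ := h
  refine ⟨b, c * w, hb.symm, hc.symm.trans ?_, (mul_assoc b c w).symm⟩
  exact Associates.mk_eq_mk_iff_associated.2 ⟨w, rfl⟩

theorem cons_mem_factorizations_mul_iff {u b : H} {hu : Irreducible (Associates.mk u)}
    {z : Factorization H} :
    ⟨Associates.mk u, hu⟩ ::ₘ z ∈ factorizations (u * b) ↔ z ∈ factorizations b := by
  obtain ⟨c, hc⟩ := Associates.mk_surjective (factorizationValue z)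
  have hcons : factorizationValue (⟨Associates.mk u, hu⟩ ::ₘ z) = Associates.mk (u * c) := by
    rw [← Associates.mk_mul_mk, hc]
    simp [factorizationValue]
  rw [mem_factorizations_iff, mem_factorizations_iff, hcons, ← hc,
    Associates.mk_eq_mk_iff_associated, Associates.mk_eq_mk_iff_associated]
  exact ⟨associated_of_mul_left_cancel, fun h => h.mul_left u⟩

theorem mem_setOfLengths_iff_exists_factorization {a : H} {k : ℕ} :
    k ∈ setOfLengths a ↔ ∃ z ∈ factorizations a, z.card = k := by
  rw [mem_setOfLengths_iff]
  constructor
  · rintro ⟨s, rfl, hs, hsa⟩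
    refine ⟨s.pmap (fun x hx => ⟨Associates.mk x, irreducible_associatesMk_iff.2 hx⟩) hs, ?_,
      s.card_pmap _ hs⟩
    rw [mem_factorizations_iff, factorizationValue, Multiset.map_pmap, Multiset.pmap_eq_map,
      Associates.prod_mk, Associates.mk_eq_mk_iff_associated]
    exact hsa
  · rintro ⟨z, hz, rfl⟩
    refine ⟨z.map fun p => Quot.out p.1, by simp, ?_, ?_⟩
    · intro x hx
      obtain ⟨p, -, rfl⟩ := Multiset.mem_map.1 hx
      rw [← irreducible_associatesMk_iff, Associates.quot_out]
      exact p.2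
    · rw [← Associates.mk_eq_mk_iff_associated, ← Associates.prod_mk, Multiset.map_map,
        ← mem_factorizations_iff.1 hz]
      simp only [Function.comp_def, Associates.quot_out, factorizationValue]

theorem IsAtomicMonoid.exists_mem_factorizations_iff_dvd (hH : IsAtomicMonoid H) {u a : H}
    (hu : Irreducible (Associates.mk u)) :
    (∃ z ∈ factorizations a, ⟨Associates.mk u, hu⟩ ∈ z) ↔ u ∣ a := by
  constructor
  · rintro ⟨z, hz, huz⟩
    rw [← Associates.mk_dvd_mk, ← mem_factorizations_iff.1 hz]
    exact Multiset.dvd_prod (Multiset.mem_map_of_mem _ huz)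
  · rintro ⟨b, rfl⟩
    obtain ⟨k, hk⟩ := hH.setOfLengths_nonempty b
    obtain ⟨z, hz, -⟩ := mem_setOfLengths_iff_exists_factorization.1 hk
    exact ⟨_, cons_mem_factorizations_mul_iff.2 hz, Multiset.mem_cons_self _ _⟩

theorem factorizationDist_add_right_le (z z' r : Factorization H) :
    factorizationDist (z + r) (z' + r) ≤ max z.card z'.card := by
  classical
  have hr : r ≤ (z + r) ∩ (z' + r) :=
    le_inf (Multiset.le_add_left _ _) (Multiset.le_add_left _ _)
  have hcard (y : Factorization H) : (y + r - (z + r) ∩ (z' + r)).card ≤ y.card := by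
    simpa using Multiset.card_le_card (tsub_le_tsub_left hr (y + r))
  unfold factorizationDist
  convert max_le_max (hcard z) (hcard z')

theorem card_le_card_add_factorizationDist (z z' : Factorization H) :
    z.card ≤ z'.card + factorizationDist z z' ∧ z'.card ≤ z.card + factorizationDist z z' := by
  classical
  have hl : z ∩ z' ≤ z := inf_le_left
  have hr : z ∩ z' ≤ z' := inf_le_right
  have hcl := Multiset.card_le_card hl
  have hcr := Multiset.card_le_card hr
  have hdist : factorizationDist z z' =
      max (z.card - (z ∩ z').card) (z'.card - (z ∩ z').card) := by
    rw [← Multiset.card_sub hl, ← Multiset.card_sub hr]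
    unfold factorizationDist
    convert rfl
  omega

end Factorizations

section LocallyTame

theorem iSup_lt_top_iff {ι : Sort*} {f : ι → ℕ∞} :
    (⨆ i, f i) < ⊤ ↔ ∃ N : ℕ, ∀ i, f i ≤ N := by
  constructor
  · intro h
    obtain ⟨N, hN⟩ := ENat.ne_top_iff_exists.1 h.ne
    exact ⟨N, iSup_le_iff.1 hN.ge⟩
  · rintro ⟨N, hN⟩
    exact (iSup_le hN).trans_lt (ENat.natCast_lt_top N)

variable {H : Type u} [CancelCommMonoid H]

theorem tameDegree_le_iff {a : H} {x : Factorization H} {N : ℕ} :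
    tameDegree a x ≤ N ↔ ((∃ z' ∈ factorizations a, x ≤ z') →
      ∀ z ∈ factorizations a, ∃ z' ∈ factorizations a, x ≤ z' ∧ factorizationDist z z' ≤ N) := by
  constructor
  · rintro h ⟨z₀, hz₀, hx⟩ z hz
    have hmem := csInf_mem (s := {N : ℕ∞ | (∃ z' ∈ factorizations a, x ≤ z') →
      ∀ z ∈ factorizations a, ∃ z' ∈ factorizations a,
        x ≤ z' ∧ (factorizationDist z z' : ℕ∞) ≤ N}) ⟨⊤, fun h _ _ => by simpa using h⟩
    obtain ⟨z', hz', hxz', hle⟩ := hmem ⟨z₀, hz₀, hx⟩ z hz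
    exact ⟨z', hz', hxz', by exact_mod_cast hle.trans h⟩
  · exact fun h => sInf_le (by simpa using h)

theorem isLocallyTame_iff : IsLocallyTame H ↔ IsAtomicMonoid H ∧
    ∀ (u : H) (hu : Irreducible (Associates.mk u)), ∃ N : ℕ, ∀ a, u ∣ a →
      ∀ z ∈ factorizations a, ∃ z' ∈ factorizations a,
        ⟨Associates.mk u, hu⟩ ∈ z' ∧ factorizationDist z z' ≤ N := by
  refine and_congr_right fun hH => ?_
  simp only [iSup_lt_top_iff, tameDegree_le_iff, Multiset.singleton_le, Subtype.forall,
    Associates.mk_surjective.forall, hH.exists_mem_factorizations_iff_dvd]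

theorem IsStronglyPrimary.exists_subfactorization_dvd (hH : IsStronglyPrimary H) {u a : H}
    (hua : u ∣ a) {z : Factorization H} (hz : z ∈ factorizations a) :
    ∃ z₁ r b c, z₁ + r = z ∧ z₁ ∈ factorizations b ∧ r ∈ factorizations c ∧ b * c = a ∧
      u ∣ b ∧ z₁.card ≤ primaryExponent u := by
  rcases le_total z.card (primaryExponent u) with hle | hle
  · exact ⟨z, 0, a, 1, add_zero z, hz, rfl, mul_one a, hua, hle⟩
  · obtain ⟨z₁, hz₁, hcard⟩ := exists_le_card_eq hle
    obtain ⟨r, rfl⟩ := Multiset.le_iff_exists_add.1 hz₁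
    obtain ⟨b, c, hb, hc, hbc⟩ := exists_mul_eq_of_add_mem_factorizations hz
    have hub : u ∣ b := hH.dvd_of_mem_setOfLengths
      (mem_setOfLengths_iff_exists_factorization.2 ⟨z₁, hb, rfl⟩) hcard.ge
    exact ⟨z₁, r, b, c, rfl, hb, hc, hbc, hub, hcard.le⟩

theorem IsStronglyPrimary.isLocallyTame_of_bounded_cofactor (hH : IsStronglyPrimary H)
    (h : ∀ u : H, Irreducible u → ∃ C : ℕ, ∀ b, ∀ k ∈ setOfLengths (u * b),
      k ≤ primaryExponent u → ∃ l ∈ setOfLengths b, l ≤ C) : IsLocallyTame H := by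
  refine isLocallyTame_iff.2 ⟨hH.isAtomicMonoid, fun u hu => ?_⟩
  obtain ⟨C, hC⟩ := h u (irreducible_associatesMk_iff.1 hu)
  refine ⟨max (primaryExponent u) (C + 1), fun a hua z hz => ?_⟩
  obtain ⟨z₁, r, _, c, rfl, hb, hc, rfl, ⟨b, rfl⟩, hcard⟩ := hH.exists_subfactorization_dvd hua hz
  obtain ⟨l, hl, hlC⟩ :=
    hC b z₁.card (mem_setOfLengths_iff_exists_factorization.2 ⟨z₁, hb, rfl⟩) hcard
  obtain ⟨y, hy, rfl⟩ := mem_setOfLengths_iff_exists_factorization.1 hl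
  refine ⟨⟨Associates.mk u, hu⟩ ::ₘ y + r,
    add_mem_factorizations_mul (cons_mem_factorizations_mul_iff.2 hy) hc, by simp,
    (factorizationDist_add_right_le _ _ _).trans (max_le_max hcard ?_)⟩
  rw [Multiset.card_cons]
  exact Nat.succ_le_succ hlC

theorem IsStronglyPrimary.isLocallyTame_of_iSup_min_lt_top (hH : IsStronglyPrimary H)
    (h : (⨆ c : H, ((sInf (setOfLengths c) : ℕ) : ℕ∞)) < ⊤) : IsLocallyTame H := by
  obtain ⟨C, hC⟩ := iSup_lt_top_iff.1 h
  exact hH.isLocallyTame_of_bounded_cofactor fun u _ => ⟨C, fun b _ _ _ =>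
    ⟨_, Nat.sInf_mem (hH.setOfLengths_nonempty b), by exact_mod_cast hC b⟩⟩

theorem exists_bound_of_kthElasticity_lt_top {M : Type u} [Monoid M] {a : M} (ha : ¬ IsUnit a)
    {k : ℕ} (h : kthElasticity M k < ⊤) :
    ∃ R : ℕ, ∀ b : M, k ∈ setOfLengths b → ∀ l ∈ setOfLengths b, l ≤ R := by
  obtain ⟨R, hR⟩ := ENat.ne_top_iff_exists.1 h.ne
  rw [kthElasticity, if_neg fun hall => ha (hall a)] at hR
  refine ⟨R, fun b hb l hl => ?_⟩
  have hle := hR.ge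
  simp only [iSup_le_iff] at hle
  exact_mod_cast hle _ ⟨⟨b, rfl⟩, hb⟩ l hl

namespace IsStronglyPrimary

theorem exponent_le_of_pow_dvd_mul (hH : IsStronglyPrimary H) {a e v : H} (ha : ¬ IsUnit a)
    {R : ℕ} (hR : ∀ b : H, primaryExponent a ∈ setOfLengths b → ∀ l ∈ setOfLengths b, l ≤ R)
    (hae : ¬ a ∣ e) (hv : Irreducible v) {T : ℕ} (h : a ^ T ∣ e * v) : T ≤ R := by
  obtain ⟨f, hf⟩ := h
  obtain ⟨i, hi⟩ := hH.setOfLengths_nonempty a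
  obtain ⟨j, hj⟩ := hH.setOfLengths_nonempty e
  obtain ⟨l, hl⟩ := hH.setOfLengths_nonempty f
  have hjlt : j < primaryExponent a := not_le.1 (mt (hH.dvd_of_mem_setOfLengths hj) hae)
  have hpad := mul_mem_setOfLengths_pow (one_mem_setOfLengths_iff.2 hv)
    (primaryExponent a - (j + 1))
  have hshort := add_mem_setOfLengths_mul
    (add_mem_setOfLengths_mul hj (one_mem_setOfLengths_iff.2 hv)) hpad
  rw [mul_one, Nat.add_sub_cancel' hjlt] at hshort
  have hlong := add_mem_setOfLengths_mul
    (add_mem_setOfLengths_mul (mul_mem_setOfLengths_pow hi T) hl) hpad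
  rw [← hf] at hlong
  have hle := hR _ hshort _ hlong
  have hT := Nat.le_mul_of_pos_right T (pos_of_mem_setOfLengths ha hi)
  omega

theorem exponent_le_of_pow_dvd_prod (hH : IsStronglyPrimary H) {a : H} (ha : ¬ IsUnit a)
    {R : ℕ} (hR : ∀ b : H, primaryExponent a ∈ setOfLengths b → ∀ l ∈ setOfLengths b, l ≤ R)
    {s : Multiset H} (hs : ∀ x ∈ s, Irreducible x) {T : ℕ} (h : a ^ T ∣ s.prod) :
    T ≤ s.card * R := by
  induction s using Multiset.induction_on generalizing T with
  | empty =>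
    rw [Multiset.prod_zero, ← pow_zero a] at h
    simpa using le_of_pow_dvd_pow ha h
  | cons v t ih =>
    rw [Multiset.forall_mem_cons] at hs
    obtain ⟨e, he, hae⟩ := (hH.finiteMultiplicity ha t.prod).exists_eq_pow_mul_and_not_dvd
    set S := multiplicity a t.prod
    have hS : S ≤ t.card * R := ih hs.2 ⟨e, he⟩
    have hT : T - S ≤ R := by
      rcases le_total T S with hle | hle
      · simp [Nat.sub_eq_zero_of_le hle]
      · refine hH.exponent_le_of_pow_dvd_mul ha hR hae hs.1
          (dvd_of_mul_dvd_mul_left (a := a ^ S) ?_)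
        rwa [← pow_add, Nat.add_sub_cancel' hle, ← mul_assoc, ← he, mul_comm,
          ← Multiset.prod_cons]
    rw [Multiset.card_cons, add_mul, one_mul]
    omega

theorem exists_length_bound (hH : IsStronglyPrimary H) {a : H} (ha : ¬ IsUnit a)
    (h : kthElasticity H (primaryExponent a) < ⊤) (n : ℕ) :
    ∃ C : ℕ, ∀ b : H, ∀ k ∈ setOfLengths b, k ≤ n → ∀ l ∈ setOfLengths b, l ≤ C := by
  obtain ⟨R, hR⟩ := exists_bound_of_kthElasticity_lt_top ha h
  set m := primaryExponent a
  refine ⟨m * (n * R + 1), fun b k hk hkn l hl => ?_⟩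
  obtain ⟨s, rfl, hs, hsb⟩ := mem_setOfLengths_iff.1 hk
  have hdvd : a ^ (l / m) ∣ s.prod :=
    (hH.pow_dvd_of_mem_setOfLengths hl (Nat.div_mul_le_self l m)).trans hsb.symm.dvd
  calc l ≤ m * (l / m + 1) := (Nat.lt_mul_div_succ l (hH.primaryExponent_pos a)).le
    _ ≤ m * (s.card * R + 1) := by
      gcongr
      exact hH.exponent_le_of_pow_dvd_prod ha hR hs hdvd
    _ ≤ m * (n * R + 1) := by gcongr

theorem isLocallyTame_of_kthElasticity_lt_top (hH : IsStronglyPrimary H) {a : H}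
    (ha : ¬ IsUnit a) (h : kthElasticity H (primaryExponent a) < ⊤) : IsLocallyTame H := by
  refine hH.isLocallyTame_of_bounded_cofactor fun u hu => ?_
  obtain ⟨C, hC⟩ := hH.exists_length_bound ha h (primaryExponent u)
  refine ⟨C, fun b k hk hkn => ?_⟩
  obtain ⟨l, hl⟩ := hH.setOfLengths_nonempty b
  have hlC := hC _ k hk hkn _ (add_mem_setOfLengths_mul (one_mem_setOfLengths_iff.2 hu) hl)
  exact ⟨l, hl, by omega⟩

end IsStronglyPrimary

end LocallyTame

section BoundedDistances

variable {H : Type u} [CancelCommMonoid H]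

theorem IsLocallyTame.exists_near_length_irreducible (hT : IsLocallyTame H) {u : H}
    (hu : Irreducible u) :
    ∃ T : ℕ, ∀ b, ∀ l ∈ setOfLengths (u * b), ∃ l' ∈ setOfLengths b,
      l ≤ l' + 1 + T ∧ l' + 1 ≤ l + T := by
  have hu' := irreducible_associatesMk_iff.2 hu
  obtain ⟨T, hT⟩ := (isLocallyTame_iff.1 hT).2 u hu'
  refine ⟨T, fun b l hl => ?_⟩
  obtain ⟨z, hz, rfl⟩ := mem_setOfLengths_iff_exists_factorization.1 hl
  obtain ⟨z', hz', huz', hdist⟩ := hT _ (dvd_mul_right u b) z hz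
  obtain ⟨y, rfl⟩ := Multiset.exists_cons_of_mem huz'
  refine ⟨y.card, mem_setOfLengths_iff_exists_factorization.2
    ⟨y, cons_mem_factorizations_mul_iff.1 hz', rfl⟩, ?_⟩
  have hcard := card_le_card_add_factorizationDist z (⟨Associates.mk u, hu'⟩ ::ₘ y)
  rw [Multiset.card_cons] at hcard
  omega

theorem IsLocallyTame.exists_near_length_prod (hT : IsLocallyTame H) {s : Multiset H}
    (hs : ∀ x ∈ s, Irreducible x) :
    ∃ T : ℕ, ∀ b, ∀ l ∈ setOfLengths (s.prod * b), ∃ l' ∈ setOfLengths b,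
      l ≤ l' + s.card + T ∧ l' + s.card ≤ l + T := by
  induction s using Multiset.induction_on with
  | empty => exact ⟨0, fun b l hl => ⟨l, by simpa using hl, by simp⟩⟩
  | cons v t ih =>
    rw [Multiset.forall_mem_cons] at hs
    obtain ⟨T, hT₁⟩ := ih hs.2
    obtain ⟨T', hT₂⟩ := hT.exists_near_length_irreducible hs.1
    refine ⟨T + T', fun b l hl => ?_⟩
    rw [Multiset.prod_cons, mul_assoc] at hl
    obtain ⟨l₁, hl₁, _⟩ := hT₂ _ l hl
    obtain ⟨l₂, hl₂, _⟩ := hT₁ _ l₁ hl₁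
    refine ⟨l₂, hl₂, ?_⟩
    rw [Multiset.card_cons]
    omega

theorem IsLocallyTame.exists_near_length (hT : IsLocallyTame H) {a : H} {k : ℕ}
    (hk : k ∈ setOfLengths a) :
    ∃ T : ℕ, ∀ b, ∀ l ∈ setOfLengths (a * b), ∃ l' ∈ setOfLengths b,
      l ≤ l' + k + T ∧ l' + k ≤ l + T := by
  obtain ⟨s, rfl, hs, hsa⟩ := mem_setOfLengths_iff.1 hk
  obtain ⟨T, hT⟩ := hT.exists_near_length_prod hs
  refine ⟨T, fun b l hl => hT b l ?_⟩
  rwa [setOfLengths_eq_of_associated (hsa.mul_right b)]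

/- A gap of length `d` in `L(u * c)` would persist, shifted by `1`, in `L(c)`: lengths of `c` near
the two ends of the gap cannot, after adding `1`, fall inside it. -/
theorem IsStronglyPrimary.exists_length_between (hH : IsStronglyPrimary H) {u : H}
    (hu : Irreducible u) {T d : ℕ} (hTd : T < d) (hud : primaryExponent u ≤ d)
    (hT : ∀ b, ∀ l ∈ setOfLengths (u * b), ∃ l' ∈ setOfLengths b,
      l ≤ l' + 1 + T ∧ l' + 1 ≤ l + T)
    {b : H} {p q x : ℕ} (hp : p ∈ setOfLengths b) (hq : q ∈ setOfLengths b) (hpx : p ≤ x)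
    (hxq : x + d ≤ q) : ∃ l ∈ setOfLengths b, x < l ∧ l < x + d := by
  induction x using Nat.strong_induction_on generalizing b p q with
  | h x ih =>
    obtain ⟨c, rfl⟩ := hH.dvd_of_mem_setOfLengths (a := u) hq (by omega)
    have hsucc {l : ℕ} (hl : l ∈ setOfLengths c) : l + 1 ∈ setOfLengths (u * c) :=
      add_comm 1 l ▸ add_mem_setOfLengths_mul (one_mem_setOfLengths_iff.2 hu) hl
    obtain ⟨p', hp', _⟩ := hT c p hp
    obtain ⟨q', hq', _⟩ := hT c q hq
    by_contra! hgap
    have hp'x : p' + 1 ≤ x := by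
      have := hgap _ (hsucc hp')
      omega
    have hxq' : x + d ≤ q' + 1 := hgap _ (hsucc hq') (by omega)
    obtain ⟨l, hl, _⟩ := ih (x - 1) (by omega) hp' hq' (by omega) (by omega)
    have := hgap _ (hsucc hl)
    omega

theorem IsLocallyTame.exists_distance_bound (hT : IsLocallyTame H) (hH : IsStronglyPrimary H) :
    ∃ D : ℕ, ∀ d ∈ distanceSet H, d ≤ D := by
  obtain ⟨u, hu⟩ := hH.exists_irreducible
  obtain ⟨T, hT⟩ := hT.exists_near_length_irreducible hu
  refine ⟨max T (primaryExponent u), fun d hd => ?_⟩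
  obtain ⟨a, -, x, hx, hxd, hgap⟩ := mem_distanceSet.1 hd
  by_contra! hlt
  rw [max_lt_iff] at hlt
  obtain ⟨l, hl, hbetween⟩ :=
    hH.exists_length_between hu hlt.1 hlt.2.le hT hx hxd le_rfl le_rfl
  exact hgap l hl hbetween

theorem IsLocallyTame.finite_distanceSet (hT : IsLocallyTame H) (hH : IsStronglyPrimary H) :
    (distanceSet H).Finite := by
  obtain ⟨D, hD⟩ := hT.exists_distance_bound hH
  exact (Set.finite_Iic D).subset hD

end BoundedDistances

section Multiprogressions

theorem mem_pair_add_range_iff {d t : ℤ} :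
    t ∈ ({0, d} : Set ℤ) + Set.range (fun k : ℤ => d * k) ↔ d ∣ t := by
  constructor
  · rintro ⟨x, hx, _, ⟨k, rfl⟩, rfl⟩
    refine dvd_add ?_ (dvd_mul_right d k)
    rcases hx with rfl | rfl
    exacts [dvd_zero d, dvd_rfl]
  · rintro ⟨k, rfl⟩
    exact ⟨0, by simp, d * k, ⟨k, rfl⟩, zero_add _⟩

theorem isAAMP_of_progression_subset {d M : ℕ} {y m : ℤ} {L : Set ℤ} (hd : 0 < d) (hm : 0 ≤ m)
    (hdm : (d : ℤ) ∣ m) (hmod : ∀ x ∈ L, (d : ℤ) ∣ x - y)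
    (hmem : ∀ t ∈ Set.Icc 0 m, (d : ℤ) ∣ t → y + t ∈ L)
    (hbound : L ⊆ Set.Icc (y - M) (y + m + M)) : IsAAMP d {0, (d : ℤ)} M L := by
  refine ⟨hd, subset_rfl, ?_, y, m, {t | t < 0 ∧ y + t ∈ L}, {t | (d : ℤ) ∣ t} ∩ Set.Icc 0 m,
    {t | m < t ∧ y + t ∈ L}, ?_, fun x hx => ?_, (Set.finite_Icc 0 m).inter_of_right _,
    ⟨⟨dvd_zero _, le_rfl, hm⟩, fun t ht => ht.2.1⟩, ⟨⟨hdm, hm, le_rfl⟩, fun t ht => ht.2.2⟩,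
    ?_, ?_, ?_⟩
  · rintro t (rfl | rfl) <;> simp
  · ext x
    rw [Set.singleton_add, ← sub_add_cancel x y, add_comm _ y,
      (add_right_injective y).mem_set_image]
    constructor
    · intro hx
      rcases lt_or_ge (x - y) 0 with h | h
      · exact Or.inl (Or.inl ⟨h, hx⟩)
      rcases lt_or_ge m (x - y) with h' | h'
      · exact Or.inr ⟨h', hx⟩
      · exact Or.inl (Or.inr ⟨by simpa using hmod _ hx, h, h'⟩)
    · rintro ((⟨-, hx⟩ | ⟨hx, h⟩) | ⟨-, hx⟩)
      exacts [hx, hmem _ h hx, hx]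
  · rw [add_assoc, Set.singleton_add]
    exact ⟨x - y, mem_pair_add_range_iff.2 (hmod x hx), add_sub_cancel y x⟩
  · ext t
    rw [Set.mem_inter_iff, Set.mem_inter_iff, mem_pair_add_range_iff, Set.mem_ofPred_eq]
  · rintro t ⟨ht, hyt⟩
    have := (hbound hyt).1
    exact ⟨by omega, by omega⟩
  · rintro t ⟨ht, hyt⟩
    have := (hbound hyt).2
    exact ⟨by omega, by omega⟩

theorem IsAAMP.mono {d M N : ℕ} {P L : Set ℤ} (h : IsAAMP d P M L) (hMN : M ≤ N) :
    IsAAMP d P N L := by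
  obtain ⟨hd, hP, hP', y, m, L₁, Lc, L₂, hL, hL', hfin, hmin, hmax, hLc, hL₁, hL₂⟩ := h
  exact ⟨hd, hP, hP', y, m, L₁, Lc, L₂, hL, hL', hfin, hmin, hmax, hLc,
    hL₁.trans (Set.Icc_subset_Icc_left (by omega)), hL₂.trans (Set.Icc_subset_Icc_right (by omega))⟩

theorem exists_mem_add_mul_eq {A : Set ℕ} {p q d D i : ℕ} (hd : 0 < d) (hp : p ∈ A) (hq : q ∈ A)
    (hmod : ∀ k ∈ A, ∀ l ∈ A, (d : ℤ) ∣ (l : ℤ) - k) (hD : ∀ e ∈ distances A, e ≤ D)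
    (hi : p + i * d ≤ q + D * d) : ∃ l ∈ A, ∃ j ≤ D, l + j * d = p + i * d := by
  obtain ⟨l, hl, hle, hlt⟩ : ∃ l ∈ A, l ≤ p + i * d ∧ p + i * d ≤ l + D * d := by
    rcases lt_or_ge (p + i * d) q with h | h
    · obtain ⟨l, hl, r, hr, hle, hlt, hlr⟩ := exists_consecutive hp hq (Nat.le_add_right p _) h
      have := hD _ (sub_mem_distances hl hr (hle.trans_lt hlt) hlr)
      have := Nat.le_mul_of_pos_right D hd
      exact ⟨l, hl, hle, by omega⟩
    · exact ⟨q, hq, h, hi⟩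
  have hdvd : d ∣ p + i * d - l := by
    have := dvd_add (hmod l hl p hp) (dvd_mul_left (d : ℤ) i)
    rw [← Int.natCast_dvd_natCast, Nat.cast_sub hle]
    push_cast
    rwa [add_sub_right_comm]
  obtain ⟨j, hj⟩ := exists_eq_mul_left_of_dvd hdvd
  exact ⟨l, hl, j, Nat.le_of_mul_le_mul_right (c := d) (by omega) hd, by omega⟩

theorem sInf_distanceSet_pos {M : Type u} [Monoid M] (hne : (distanceSet M).Nonempty) :
    0 < sInf (distanceSet M) := by
  obtain ⟨L, -, hd, -⟩ := Set.mem_iUnion₂.1 (Nat.sInf_mem hne)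
  exact hd

variable {H : Type u} [CommMonoid H]

theorem isAAMP_setOfLengths_of_le (hne : (distanceSet H).Nonempty) {b : H} {M : ℕ}
    (hb : (setOfLengths b).Nonempty) (hM : ∀ l ∈ setOfLengths b, l ≤ M) :
    IsAAMP (sInf (distanceSet H)) {0, ((sInf (distanceSet H) : ℕ) : ℤ)} M
      ((fun n : ℕ => (n : ℤ)) '' setOfLengths b) := by
  obtain ⟨y, hy⟩ := hb
  refine isAAMP_of_progression_subset (y := y) (sInf_distanceSet_pos hne) le_rfl (dvd_zero _)
    ?_ ?_ ?_
  · rintro _ ⟨x, hx, rfl⟩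
    exact sInf_distanceSet_dvd_sub hne hy hx
  · rintro t ht -
    obtain rfl : t = 0 := by simpa using ht
    exact ⟨y, hy, (add_zero _).symm⟩
  · rintro _ ⟨x, hx, rfl⟩
    have := hM x hx
    have := hM y hy
    simp only [Set.mem_Icc]
    omega

/- Every term of the progression with difference `d` that starts at the smallest and ends `D * d`
beyond the largest length of `r` is a length of `r` plus one of the multiples `0, d, …, D * d`,
and `a ^ D` provides all of these. -/
theorem isAAMP_setOfLengths_pow_mul (hne : (distanceSet H).Nonempty) {a r : H} {k p q D T : ℕ}
    (hk : k ∈ setOfLengths a) (hkd : k + sInf (distanceSet H) ∈ setOfLengths a)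
    (hD : ∀ d ∈ distanceSet H, d ≤ D)
    (hT : ∀ l ∈ setOfLengths (a ^ D * r), ∃ l' ∈ setOfLengths r,
      l ≤ l' + D * k + T ∧ l' + D * k ≤ l + T)
    (hp : IsLeast (setOfLengths r) p) (hq : IsGreatest (setOfLengths r) q) :
    IsAAMP (sInf (distanceSet H)) {0, ((sInf (distanceSet H) : ℕ) : ℤ)} T
      ((fun n : ℕ => (n : ℤ)) '' setOfLengths (a ^ D * r)) := by
  have hd := sInf_distanceSet_pos hne
  have hmod (b : H) {l l' : ℕ} (hl : l ∈ setOfLengths b) (hl' : l' ∈ setOfLengths b) :=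
    sInf_distanceSet_dvd_sub hne hl hl'
  set d := sInf (distanceSet H)
  have hmem {l j : ℕ} (hl : l ∈ setOfLengths r) (hj : j ≤ D) :
      D * k + j * d + l ∈ setOfLengths (a ^ D * r) :=
    add_mem_setOfLengths_mul (mul_add_mul_mem_setOfLengths_pow hk hkd hj) hl
  refine isAAMP_of_progression_subset (y := (D * k + 0 * d + p : ℕ)) (m := q - p + D * d) hd ?_
    (dvd_add (hmod r hp.1 hq.1) (dvd_mul_left _ _)) ?_ ?_ ?_
  · have : (p : ℤ) ≤ q := by exact_mod_cast hp.2 hq.1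
    exact add_nonneg (sub_nonneg.2 this) (by positivity)
  · rintro _ ⟨x, hx, rfl⟩
    exact hmod _ (hmem hp.1 (Nat.zero_le D)) hx
  · rintro _ ⟨h0, hm⟩ ⟨i, rfl⟩
    have hi : 0 ≤ i := nonneg_of_mul_nonneg_right h0 (by exact_mod_cast hd)
    lift i to ℕ using hi
    have hiq : p + i * d ≤ q + D * d := by
      zify
      linarith
    obtain ⟨l, hl, j, hj, hlj⟩ := exists_mem_add_mul_eq hd hp.1 hq.1
      (fun _ hl _ hl' => hmod r hl hl') (fun e he => hD e (mem_distanceSet.2 ⟨r, he⟩)) hiq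
    refine ⟨_, hmem hl hj, ?_⟩
    zify at hlj ⊢
    linarith
  · rintro _ ⟨x, hx, rfl⟩
    obtain ⟨l, hl, hle, hge⟩ := hT x hx
    have : p ≤ l := hp.2 hl
    have : l ≤ q := hq.2 hl
    have : 0 ≤ D * d := Nat.zero_le _
    simp only [Set.mem_Icc]
    push_cast
    omega

end Multiprogressions

theorem IsLocallyTame.exists_isAAMP {H : Type u} [CancelCommMonoid H] (hT : IsLocallyTame H)
    (hH : IsStronglyPrimary H) (hne : (distanceSet H).Nonempty) :
    ∃ M : ℕ, ∀ L ∈ lengthSystem H,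
      IsAAMP (sInf (distanceSet H)) {0, ((sInf (distanceSet H) : ℕ) : ℤ)} M
        ((fun n : ℕ => (n : ℤ)) '' L) := by
  obtain ⟨D, hD⟩ := hT.exists_distance_bound hH
  obtain ⟨a, -, k, hk, hkd, -⟩ := mem_distanceSet.1 (Nat.sInf_mem hne)
  obtain ⟨T, hT⟩ := hT.exists_near_length (mul_mem_setOfLengths_pow hk D)
  refine ⟨max T (primaryExponent (a ^ D)), ?_⟩
  rintro _ ⟨b, rfl⟩
  have hb := hH.setOfLengths_nonempty b
  by_cases hshort : ∀ l ∈ setOfLengths b, l ≤ primaryExponent (a ^ D)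
  · exact (isAAMP_setOfLengths_of_le hne hb hshort).mono (le_max_right _ _)
  · push Not at hshort
    obtain ⟨l, hl, hlong⟩ := hshort
    obtain ⟨r, rfl⟩ := hH.dvd_of_mem_setOfLengths hl hlong.le
    obtain ⟨q, hq⟩ := hH.exists_isGreatest_setOfLengths r
    have hp : IsLeast (setOfLengths r) (sInf (setOfLengths r)) :=
      ⟨Nat.sInf_mem (hH.setOfLengths_nonempty r), fun l hl => Nat.sInf_le hl⟩
    exact (isAAMP_setOfLengths_pow_mul hne hk hkd hD (hT r) hp hq).mono (le_max_left _ _)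

end FactorizationTheory

theorem theorem5p5 (H : Type u) [CancelCommMonoid H]
    (hH : IsStronglyPrimary H) (hnhf : ¬ IsHalfFactorial H) :
    (∃ β : ℚ, 1 < β ∧
      ∀ L ∈ lengthSystem H, elasticity L ≠ 1 → ENNReal.ofReal (β : ℝ) ≤ elasticity L) ∧
    ((∀ (G : Type v) [AddCommGroup G] (G₀ : Set G),
        lengthSystem H ≠ lengthSystem (ZeroSumMonoid G₀)) ∧
      ¬ IsTransferKrull.{u, v} H) ∧
    (((⨆ c : H, ((sInf (setOfLengths c) : ℕ) : ℕ∞)) < ⊤ → IsLocallyTame H) ∧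
      ((∃ a : H, ¬ IsUnit a ∧ kthElasticity H (primaryExponent a) < ⊤) → IsLocallyTame H) ∧
      (IsLocallyTame H →
        (distanceSet H).Finite ∧
        ∃ M : ℕ, ∀ L ∈ lengthSystem H,
          IsAAMP (sInf (distanceSet H)) {0, ((sInf (distanceSet H) : ℕ) : ℤ)} M
            ((fun n : ℕ => (n : ℤ)) '' L))) :=
  ⟨hH.exists_elasticity_gap hnhf,
    ⟨fun _ _ G₀ => hH.lengthSystem_ne_of_isSaturated hnhf (isSaturated_zeroSumSequences G₀),
      hH.not_isTransferKrull hnhf⟩,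
    hH.isLocallyTame_of_iSup_min_lt_top,
    fun ⟨_, ha, h⟩ => hH.isLocallyTame_of_kthElasticity_lt_top ha h,
    fun hT => ⟨hT.finite_distanceSet hH,
      hT.exists_isAAMP hH (hH.isAtomicMonoid.distanceSet_nonempty hnhf)⟩⟩
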